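/- Let $n\ge 1$. For a convex body $K\subset\mathbb R^n$ (compact, convex, with nonempty interior) write $K\in C^2_+$ if $\partial K$ is of class $C^2$ with everywhere strictly positive Gauss curvature $\kappa_K$. Let $h_K(u)=\max_{x\in K}\langle x,u\rangle$ be the support function of $K$ and, for $K\in C^2_+$ and $u\in S^{n-1}$, let $f_K(u)=1/\kappa_K(x)$, where $x\in\partial K$ is the unique point at which $u$ is the outer unit normal. Let $\sigma$ be the surface area measure on $S^{n-1}$. For convex bodies $K_1,\dots,K_n\in C^2_+$ with centroid at the origin, the mixed $p$-affine surface area is $$as_p(K_1,\dots,K_n)=\int_{S^{n-1}}\Big[\prod_{i=1}^n h_{K_i}(u)^{1-p}f_{K_i}(u)\Big]^{\frac1{n+p}}\,d\sigma(u)\qquad(p\in\mathbb R,\ p\ne -n),$$ $$as_{\pm\infty}(K_1,\dots,K_n)=\int_{S^{n-1}}\prod_{i=1}^n\frac1{h_{K_i}(u)}\,d\sigma(u).$$ **Lemma.** Let $K_1,\dots,K_n\in C^2_+$ be convex bodies in $\mathbb R^n$ with centroid at the origin and let $T:\mathbb R^n\to\mathbb R^n$ be an invertible linear map. Then for all $p\in[-\infty,\infty]$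 with $p\neq -n$, $$as_p(TK_1,\dots,TK_n)=|\det T|^{\frac{n-p}{n+p}}\,as_p(K_1,\dots,K_n),$$ where the exponent $\frac{n-p}{n+p}$ is read as its limit $-1$ for $p=\pm\infty$. In particular, if $|\det T|=1$, then $as_p(TK_1,\dots,TK_n)=as_p(K_1,\dots,K_n)$ for all such $p$. -/

import Mathlib

open MeasureTheory Metric Filter Topology
open scoped RealInnerProductSpace

namespace MixedAffine

noncomputable section

/-- Euclidean space `ℝⁿ`. -/
abbrev E (n : ℕ) : Type := EuclideanSpace ℝ (Fin n)

/-- The support function `h_K(u) = sup_{x ∈ K} ⟨x, u⟩`. -/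
def supportFun {n : ℕ} (K : Set (E n)) (u : E n) : ℝ :=
  sSup ((fun x : E n => ⟪x, u⟫) '' K)

/-- `u` is an outer unit normal vector of the convex set `K` at its boundary point `x`. -/
def IsOuterUnitNormal {n : ℕ} (K : Set (E n)) (x u : E n) : Prop :=
  x ∈ frontier K ∧ ‖u‖ = 1 ∧ ∀ y ∈ K, ⟪y, u⟫ ≤ ⟪x, u⟫

open Classical in
/-- The Gauss map `N_K`: the outer unit normal at `x ∈ ∂K` (unique if `∂K` is smooth;
the value `0` is used where there is none). -/
def gaussMap {n : ℕ} (K : Set (E n)) (x : E n) : E n :=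
  if h : ∃ u, IsOuterUnitNormal K x u then h.choose else 0

/-- The determinant of the endomorphism `v ↦ P (A v)` of the hyperplane `u^⊥`, where `P` is the
orthogonal projection of `ℝⁿ` onto `u^⊥`. -/
def tangentDet {n : ℕ} (u : E n) (A : E n →L[ℝ] E n) : ℝ :=
  LinearMap.det
    (((ℝ ∙ u)ᗮ.orthogonalProjectionOnto ∘L A ∘L (ℝ ∙ u)ᗮ.subtypeL : (ℝ ∙ u)ᗮ →L[ℝ] (ℝ ∙ u)ᗮ) :
        (ℝ ∙ u)ᗮ →ₗ[ℝ] (ℝ ∙ u)ᗮ)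

/-- The Gauss curvature `κ_K(x)` at `x ∈ ∂K`: the determinant of the Weingarten map, i.e. of the
differential of the Gauss map `N_K : ∂K → S^{n-1}` at `x`, as an endomorphism of the tangent
hyperplane `N_K(x)^⊥`. (The derivative of `N_K` within `∂K` is determined on the tangent
hyperplane only, and it maps this hyperplane to itself; the projection in `tangentDet` just
restricts the codomain.) -/
def gaussCurvature {n : ℕ} (K : Set (E n)) (x : E n) : ℝ :=
  tangentDet (gaussMap K x) (fderivWithin ℝ (gaussMap K) (frontier K) x)

/-- `K` has `C²` boundary: near each boundary point, `K` is the sublevel set `{F ≤ 0}` of a `C²`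
function with nonvanishing differential. -/
def HasC2Boundary {n : ℕ} (K : Set (E n)) : Prop :=
  ∀ x ∈ frontier K, ∃ F : E n → ℝ,
    ContDiffAt ℝ 2 F x ∧ fderiv ℝ F x ≠ 0 ∧ ∀ᶠ y in 𝓝 x, (y ∈ K ↔ F y ≤ 0)

/-- The class `C²₊` of convex bodies (with nonempty interior) with `C²` boundary and everywhere
strictly positive Gauss curvature. -/
structure IsC2Plus {n : ℕ} (K : ConvexBody (E n)) : Prop where
  nonempty_interior : (interior (K : Set (E n))).Nonempty
  c2_boundary : HasC2Boundary (K : Set (E n))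
  curvature_pos : ∀ x ∈ frontier (K : Set (E n)), 0 < gaussCurvature (K : Set (E n)) x

/-- The centroid `|K|⁻¹ ∫_K x dx`. -/
def centroid {n : ℕ} (K : Set (E n)) : E n := ⨍ x in K, x

open Classical in
/-- The curvature function `f_K(u) = 1 / κ_K(x)`, where `x ∈ ∂K` is the point at which `u` is the
outer unit normal (it exists and is unique for `K` in `C²₊`). -/
def curvatureFun {n : ℕ} (K : Set (E n)) (u : E n) : ℝ :=
  if h : ∃ x, IsOuterUnitNormal K x u then (gaussCurvature K h.choose)⁻¹ else 0

/-- The mixed `p`-affine surface area of `K₁, …, Kₙ`, for real `p ≠ -n`: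
`∫_{S^{n-1}} [h_{K₁}(u)^{1-p} f_{K₁}(u) ⋯ h_{Kₙ}(u)^{1-p} f_{Kₙ}(u)]^{1/(n+p)} dσ(u)`. -/
def mixedAffineSurfaceArea {n : ℕ} (p : ℝ) (K : Fin n → Set (E n)) : ℝ :=
  ∫ u : sphere (0 : E n) 1,
    (∏ i, supportFun (K i) u ^ (1 - p) * curvatureFun (K i) u) ^ (1 / ((n : ℝ) + p))
    ∂(volume : Measure (E n)).toSphere

/-- The mixed `p`-affine surface area for `p = ∞`, which is also the one for `p = -∞`:
`∫_{S^{n-1}} 1 / (h_{K₁}(u) ⋯ h_{Kₙ}(u)) dσ(u)`. -/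
def mixedAffineSurfaceAreaInfty {n : ℕ} (K : Fin n → Set (E n)) : ℝ :=
  ∫ u : sphere (0 : E n) 1, ∏ i, 1 / supportFun (K i) u ∂(volume : Measure (E n)).toSphere

end

end MixedAffine

/-! Put `R` for the adjoint of `T`, `d = |det T|`, and for a unit vector `u` put `b = ‖R u‖`, `v = R
u / b`. Since `⟪T x, u⟫ = ⟪x, R u⟫`, the point of `K` with normal `v` is carried by `T` to the point
of `TK` with normal `u`, and `h_{TK}(u) = b h_K(v)` (`supportFun_image_eq`).

The Gauss map of `TK` at `T x` is the normalization of `R⁻¹ N_K(x)`. Differentiating along curves in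
`∂K` and discarding the radial component gives the Weingarten map `b P R⁻¹ (dN_K) T⁻¹` on `u^⊥`,
where `P` projects onto `u^⊥`. Its determinant is `b^(n+1) / d²` times that of `dN_K`
(`tangentDet_conj`, `IsC2Plus.gaussCurvature_image`), so `f_{TK}(u) = d² b^(-(n+1)) f_K(v)`.

Each factor of the integrand thus acquires `d² b^(-(n+p))`. After `n` factors and the power
`1/(n+p)` this becomes `d^(2n/(n+p)) b^(-n)`, and `d b^(-n)` is exactly the Jacobian of `u ↦ v` on
the sphere (`integral_sphere_comp_normalize`). What remains is `d` to the power `2n/(n+p) - 1 =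
(n-p)/(n+p)`. For `p = ±∞` the support functions alone supply `b^(-n)`, leaving `d⁻¹`. -/

namespace MixedAffine

noncomputable section

/-! ### Determinants on tangent hyperplanes -/

section

/-- The Weinstein–Aronszajn identity for linear maps. -/
theorem det_one_add_comp_comm {U V : Type*} [AddCommGroup U] [Module ℝ U] [FiniteDimensional ℝ U]
    [AddCommGroup V] [Module ℝ V] [FiniteDimensional ℝ V] (f : U →ₗ[ℝ] V) (g : V →ₗ[ℝ] U) :
    LinearMap.det (1 + f ∘ₗ g) = LinearMap.det (1 + g ∘ₗ f) := by
  have bU := Module.finBasis ℝ U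
  have bV := Module.finBasis ℝ V
  rw [← LinearMap.det_toMatrix bV, ← LinearMap.det_toMatrix bU, map_add, map_add,
    LinearMap.toMatrix_comp bV bU bV, LinearMap.toMatrix_comp bU bV bU, LinearMap.toMatrix_one,
    LinearMap.toMatrix_one, Matrix.det_one_add_mul_comm]

theorem det_adjoint {V : Type*} [NormedAddCommGroup V] [InnerProductSpace ℝ V]
    [FiniteDimensional ℝ V] (f : V →ₗ[ℝ] V) :
    LinearMap.det (LinearMap.adjoint f) = LinearMap.det f := by
  have b := stdOrthonormalBasis ℝ V
  rw [← LinearMap.det_toMatrix b.toBasis, ← LinearMap.det_toMatrix b.toBasis,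
    LinearMap.toMatrix_adjoint, Matrix.det_conjTranspose, star_trivial]

variable {n : ℕ}

theorem projection_orthogonal_apply {u : E n} (hu : ‖u‖ = 1) (v : E n) :
    ((ℝ ∙ u)ᗮ.orthogonalProjectionOnto v : E n) = v - ⟪u, v⟫ • u := by
  rw [Submodule.coe_orthogonalProjectionOnto_apply, Submodule.starProjection_orthogonal_val,
    Submodule.starProjection_unit_singleton ℝ hu]

/-- The orthogonal projection along `u`, as an endomorphism of the full space. -/
def projAlong (u : E n) : E n →ₗ[ℝ] E n :=
  LinearMap.id - (innerₗ (E n) u).smulRight u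

theorem projAlong_apply (u v : E n) : projAlong u v = v - ⟪u, v⟫ • u := by
  simp [projAlong]

/-- The endomorphism on the right is the compression of `A` on `u^⊥` and the identity on `ℝ u`. On
the whole space, maps between different hyperplanes can be composed and their determinants
multiplied. -/
theorem tangentDet_eq_det {u : E n} (hu : ‖u‖ = 1) (A : E n →L[ℝ] E n) :
    tangentDet u A = LinearMap.det
      (projAlong u ∘ₗ A.toLinearMap ∘ₗ projAlong u + (innerₗ (E n) u).smulRight u) := by
  set U := (ℝ ∙ u)ᗮ
  let p : E n →ₗ[ℝ] U := U.orthogonalProjectionOnto.toLinearMap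
  let X : U →ₗ[ℝ] U := p ∘ₗ A.toLinearMap ∘ₗ U.subtype
  have hp : ∀ v, ((p v : U) : E n) = v - ⟪u, v⟫ • u := projection_orthogonal_apply hu
  have hpi : ∀ v : U, p v = v := fun v => Submodule.orthogonalProjectionOnto_mem_subspace_eq_self v
  have h1 : projAlong u ∘ₗ A.toLinearMap ∘ₗ projAlong u + (innerₗ (E n) u).smulRight u
      = 1 + U.subtype ∘ₗ ((X - 1) ∘ₗ p) := by
    ext1 v
    simp [X, projAlong_apply, hp, inner_sub_right, inner_smul_right]
    module
  rw [h1, det_one_add_comp_comm]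
  have h2 : 1 + ((X - 1) ∘ₗ p) ∘ₗ U.subtype = X := by
    ext1 v
    simp [hpi]
  rw [h2]
  rfl

/-- Needed because `fderivWithin` along a hypersurface is determined only on tangent vectors. -/
theorem tangentDet_congr {u : E n} (A B : E n →L[ℝ] E n)
    (h : ∀ v ∈ (ℝ ∙ u)ᗮ, (ℝ ∙ u)ᗮ.orthogonalProjectionOnto (A v)
      = (ℝ ∙ u)ᗮ.orthogonalProjectionOnto (B v)) :
    tangentDet u A = tangentDet u B := by
  unfold tangentDet
  congr 2
  ext1 v
  exact h v v.2

theorem finrank_orthogonal_singleton {u : E n} (hu : ‖u‖ = 1) :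
    Module.finrank ℝ (ℝ ∙ u)ᗮ + 1 = n := by
  have h0 : u ≠ 0 := by rintro rfl; simp at hu
  have h := Submodule.finrank_add_finrank_orthogonal (ℝ ∙ u)
  rw [finrank_span_singleton h0, finrank_euclideanSpace_fin] at h
  omega

theorem tangentDet_smul {u : E n} (hu : ‖u‖ = 1) (c : ℝ) (A : E n →L[ℝ] E n) :
    tangentDet u (c • A) = c ^ (n - 1) * tangentDet u A := by
  have h := finrank_orthogonal_singleton hu
  unfold tangentDet
  rw [show n - 1 = Module.finrank ℝ (ℝ ∙ u)ᗮ by omega, ← LinearMap.det_smul]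
  congr 1
  ext1 v
  simp

theorem tangentDet_eq_zero {u v : E n} (A : E n →L[ℝ] E n) (hv : v ∈ (ℝ ∙ u)ᗮ) (h0 : v ≠ 0)
    (hA : A v = 0) : tangentDet u A = 0 := by
  unfold tangentDet
  by_contra hd
  have hu := (LinearMap.isUnit_iff_isUnit_det _).2 (isUnit_iff_ne_zero.2 hd)
  have hinj := ((Module.End.isUnit_iff _).1 hu).1
  have : (⟨v, hv⟩ : (ℝ ∙ u)ᗮ) = 0 := by
    apply hinj
    simp [hA]
  exact h0 (congrArg Subtype.val this)

/-- Transformation of the determinant on the tangent hyperplane under a linear change of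
coordinates `T` mapping `u^⊥` to `u'^⊥`. -/
theorem tangentDet_conj {u u' : E n} (hu : ‖u‖ = 1) (hu' : ‖u'‖ = 1) (T : E n ≃ₗ[ℝ] E n) {b : ℝ}
    (hb : LinearMap.adjoint (T : E n →ₗ[ℝ] E n) u' = b • u) (D M : E n →L[ℝ] E n)
    (hM : ∀ v, M v = LinearMap.adjoint (T.symm : E n →ₗ[ℝ] E n) (D (T.symm v))) :
    tangentDet u' M
      = b ^ 2 / LinearMap.det (T : E n →ₗ[ℝ] E n) ^ 2 * tangentDet u D := by
  set S := LinearMap.adjoint (T.symm : E n →ₗ[ℝ] E n) with hS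
  set R := LinearMap.adjoint (T : E n →ₗ[ℝ] E n) with hR
  have huu : ⟪u, u⟫ = 1 := by simp [hu]
  have hSi : ∀ v w, ⟪S v, w⟫ = ⟪v, T.symm w⟫ := fun v w => LinearMap.adjoint_inner_left _ _ _
  have hRi : ∀ v w, ⟪R v, w⟫ = ⟪v, T w⟫ := fun v w => LinearMap.adjoint_inner_left _ _ _
  have hSR : ∀ v, S (R v) = v := fun v => ext_inner_right ℝ fun w => by simp [hSi, hRi]
  have hSu : b • S u = u' := by rw [← map_smul, ← hb, hSR]
  have hTu : ⟪u', T u⟫ = b := by rw [← hRi, hb, inner_smul_left, huu]; simp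
  have hb0 : b ≠ 0 := by
    rintro rfl
    rw [zero_smul] at hSu
    rw [← hSu] at hu'
    simp at hu'
  have hSu2 : S u = b⁻¹ • u' := by rw [← hSu, smul_smul, inv_mul_cancel₀ hb0, one_smul]
  have huT : ∀ w, ⟪u, T.symm w⟫ = b⁻¹ * ⟪u', w⟫ := fun w => by
    rw [← hSi, hSu2, inner_smul_left]; simp
  -- `B` extends `T⁻¹ : u'^⊥ → u^⊥` by `u' ↦ u`, and `C` extends the projection of `S : u^⊥ → E n`
  -- to `u'^⊥` by `u ↦ u'`. Both `T B` and `C R` are rank-one perturbations of the identity, of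
  -- determinant `1 + ⟪u', T u - u'⟫ = b`.
  let B : E n →ₗ[ℝ] E n := (T.symm : E n →ₗ[ℝ] E n) ∘ₗ projAlong u' + (innerₗ (E n) u').smulRight u
  let C : E n →ₗ[ℝ] E n := projAlong u' ∘ₗ S + (innerₗ (E n) u).smulRight u'
  have hB : (T : E n →ₗ[ℝ] E n) ∘ₗ B = LinearMap.transvection (innerₗ (E n) u') (T u - u') := by
    ext1 v
    simp [B, LinearMap.transvection.apply, projAlong_apply, smul_sub]
    abel
  have hC : C ∘ₗ R = LinearMap.transvection (innerₗ (E n) (T u - u')) u' := by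
    ext1 v
    have : ⟪u, R v⟫ = ⟪T u, v⟫ := by rw [real_inner_comm, hRi, real_inner_comm]
    simp [C, LinearMap.transvection.apply, projAlong_apply, hSR, this, sub_smul]
    abel
  have hdT : LinearMap.det (T : E n →ₗ[ℝ] E n) ≠ 0 := (LinearEquiv.isUnit_det' T).ne_zero
  have hBd : LinearMap.det B = b / LinearMap.det (T : E n →ₗ[ℝ] E n) := by
    rw [eq_div_iff hdT, mul_comm, ← LinearMap.det_comp, hB, LinearMap.transvection.det]
    simp [inner_sub_right, hTu, hu']
  have hCd : LinearMap.det C = b / LinearMap.det (T : E n →ₗ[ℝ] E n) := by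
    rw [eq_div_iff hdT, ← det_adjoint (T : E n →ₗ[ℝ] E n), ← LinearMap.det_comp, hC,
      LinearMap.transvection.det]
    simp [real_inner_comm, hTu, hu']
  rw [tangentDet_eq_det hu, tangentDet_eq_det hu']
  have hfac : projAlong u' ∘ₗ M.toLinearMap ∘ₗ projAlong u' + (innerₗ (E n) u').smulRight u'
      = C ∘ₗ (projAlong u ∘ₗ D.toLinearMap ∘ₗ projAlong u + (innerₗ (E n) u).smulRight u)
        ∘ₗ B := by
    ext1 v
    have h0 : ⟪u', projAlong u' v⟫ = 0 := by
      simp [projAlong_apply, inner_sub_right, inner_smul_right, hu']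
    have h1 : ⟪u, B v⟫ = ⟪u', v⟫ := by
      simp [B, inner_add_right, inner_smul_right, huT, h0, hu]
    have h2 : projAlong u (B v) = T.symm (projAlong u' v) := by
      rw [projAlong_apply, h1]; simp [B]
    have h3 : ∀ w, C (projAlong u w) = projAlong u' (S w) := fun w => by
      simp [C, projAlong_apply, hSu2, inner_sub_right, inner_smul_right, hu, hu']
      module
    have h4 : C u = u' := by
      simp [C, projAlong_apply, hSu2, hu, hu']
    simp only [LinearMap.add_apply, LinearMap.comp_apply, LinearMap.smulRight_apply,
      innerₗ_apply_apply, map_add, map_smul, h1, h2, h3, h4, ContinuousLinearMap.coe_coe, hM]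
  rw [hfac, LinearMap.det_comp, LinearMap.det_comp, hBd, hCd]
  ring

end

/-! ### Normals, boundary curves and strict convexity -/

section

variable {n : ℕ}

/-- A maximizer of a nonzero linear functional on `K` is a boundary point. -/
theorem mem_frontier_of_isMax {K : Set (E n)} {x u : E n} (hu : u ≠ 0) (hx : x ∈ K)
    (h : ∀ y ∈ K, ⟪y, u⟫ ≤ ⟪x, u⟫) : x ∈ frontier K := by
  refine ⟨subset_closure hx, fun hi => hu ?_⟩
  have hmax : IsLocalMax (fun y : E n => ⟪u, y⟫) x := by
    filter_upwards [mem_interior_iff_mem_nhds.1 hi] with y hy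
    simpa only [real_inner_comm u] using h y hy
  have h0 := hmax.hasFDerivAt_eq_zero (innerSL ℝ u).hasFDerivAt
  have := DFunLike.congr_fun h0 u
  simpa using this

/-- At a boundary point of a convex body with `C²` boundary, the outer unit normal exists and is
unique, and every tangent vector is the velocity of a curve in the boundary. -/
theorem HasC2Boundary.exists_normal {K : Set (E n)} (hK : HasC2Boundary K) (hc : Convex ℝ K)
    (hcl : IsClosed K) (hint : (interior K).Nonempty) {x : E n} (hx : x ∈ frontier K) :
    ∃ u, (∀ w, IsOuterUnitNormal K x w ↔ w = u) ∧
      ∀ v, ⟪u, v⟫ = 0 → ∃ γ : ℝ → E n, γ 0 = x ∧ HasDerivAt γ v 0 ∧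
        ∀ᶠ t in 𝓝 0, γ t ∈ frontier K := by
  obtain ⟨F, hF, hF0, hKF⟩ := hK x hx
  have hxK : x ∈ K := hcl.frontier_subset hx
  have hs : HasStrictFDerivAt F (fderiv ℝ F x) x := hF.hasStrictFDerivAt (by simp)
  have hFx : F x = 0 := by
    refine le_antisymm (hKF.self_of_nhds.1 hxK) (not_lt.1 fun hlt => hx.2 ?_)
    rw [mem_interior_iff_mem_nhds]
    filter_upwards [hKF, hF.continuousAt.eventually_lt continuousAt_const hlt] with y hy hy'
    exact hy.2 hy'.le
  -- A zero of `F` interior to `K` would be a local maximum of `F`, but `dF` does not vanish near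
  -- `x`.
  have hfr : ∀ᶠ y in 𝓝 x, F y = 0 → y ∈ frontier K := by
    have hcont : ContinuousAt (fderiv ℝ F) x :=
      (hF.fderiv_right (m := 1) (by norm_num [one_add_one_eq_two])).continuousAt
    filter_upwards [hKF.eventually_nhds, hcont.eventually_ne hF0] with y hy hy0 hFy
    refine ⟨subset_closure (hy.self_of_nhds.2 hFy.le), fun hi => hy0 ?_⟩
    have hmax : IsLocalMax F y := by
      filter_upwards [hy, mem_interior_iff_mem_nhds.1 hi] with z hz hzK
      rw [hFy]
      exact hz.1 hzK
    exact hmax.fderiv_eq_zero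
  set g : E n := (InnerProductSpace.toDual ℝ (E n)).symm (fderiv ℝ F x) with hg
  have hgv : ∀ v, ⟪g, v⟫ = fderiv ℝ F x v := fun v =>
    InnerProductSpace.toDual_symm_apply
  have hg0 : g ≠ 0 := by simpa [hg] using hF0
  have hgn : 0 < ‖g‖ := norm_pos_iff.2 hg0
  have hun : ‖‖g‖⁻¹ • g‖ = 1 := by simp [norm_smul, hgn.ne']
  have huv : ∀ v, ⟪‖g‖⁻¹ • g, v⟫ = ‖g‖⁻¹ * fderiv ℝ F x v := fun v => by
    rw [real_inner_smul_left, hgv]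
  have hcurve : ∀ v, ⟪‖g‖⁻¹ • g, v⟫ = 0 → ∃ γ : ℝ → E n, γ 0 = x ∧ HasDerivAt γ v 0 ∧
      ∀ᶠ t in 𝓝 0, γ t ∈ frontier K := by
    intro v hv
    rw [huv] at hv
    have hv0 : fderiv ℝ F x v = 0 := by simpa [hgn.ne'] using hv
    have hsurj : (fderiv ℝ F x).range = ⊤ := by
      rw [LinearMap.range_eq_top]
      exact LinearMap.surjective fun h => hF0 (by ext1 z; exact LinearMap.congr_fun h z)
    let k : (fderiv ℝ F x).ker := ⟨v, hv0⟩
    have hlin : HasDerivAt (fun t : ℝ => t • k) k 0 := by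
      simpa using (hasDerivAt_id (0 : ℝ)).smul_const k
    have htend : Tendsto (fun t : ℝ => t • k) (𝓝 0) (𝓝 0) := by
      simpa using hlin.continuousAt.tendsto
    -- The implicit function theorem parametrizes the level set of `F` through `x` by `ker dF`; the
    -- curve is the image of the line through `v`.
    refine ⟨fun t => hs.implicitFunction F _ hsurj (F x) (t • k), by simp, ?_, ?_⟩
    · have h1 := (hs.to_implicitFunction hsurj).hasFDerivAt
      rw [show (0 : (fderiv ℝ F x).ker) = (0 : ℝ) • k by simp] at h1
      exact h1.comp_hasDerivAt (0 : ℝ) hlin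
    · have h1 := (hs.tendsto_implicitFunction hsurj tendsto_const_nhds htend).eventually hfr
      have h2 := (tendsto_const_nhds.prodMk_nhds htend).eventually (hs.map_implicitFunction_eq hsurj)
      filter_upwards [h1, h2] with t ht1 ht2
      exact ht1 (by rw [ht2, hFx])
  have hnormal : ∀ y ∈ K, ⟪y, ‖g‖⁻¹ • g⟫ ≤ ⟪x, ‖g‖⁻¹ • g⟫ := by
    intro y hy
    have hmax : IsLocalMaxOn F K x := by
      filter_upwards [hKF.filter_mono nhdsWithin_le_nhds, self_mem_nhdsWithin] with y hy hyK
      rw [hFx]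
      exact hy.1 hyK
    have h1 := hmax.hasFDerivWithinAt_nonpos hs.hasFDerivAt.hasFDerivWithinAt
      (sub_mem_posTangentConeAt_of_segment_subset (hc.segment_subset hxK hy))
    have h2 : ⟪‖g‖⁻¹ • g, y - x⟫ ≤ 0 := by
      rw [huv]
      exact mul_nonpos_of_nonneg_of_nonpos (by positivity) h1
    rw [inner_sub_right, real_inner_comm, real_inner_comm x] at h2
    linarith
  refine ⟨‖g‖⁻¹ • g, fun w => ⟨fun hw => ?_, ?_⟩, hcurve⟩
  · set u := ‖g‖⁻¹ • g
    have hperp : ∀ v, ⟪u, v⟫ = 0 → ⟪w, v⟫ = 0 := by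
      intro v hv
      obtain ⟨γ, hγ0, hγ, hγf⟩ := hcurve v hv
      have hd : HasDerivAt (fun t => ⟪w, γ t⟫) ⟪w, v⟫ 0 :=
        (innerSL ℝ w).hasFDerivAt.comp_hasDerivAt (0 : ℝ) hγ
      refine IsLocalMax.hasDerivAt_eq_zero ?_ hd
      filter_upwards [hγf] with t ht
      simpa only [real_inner_comm w, hγ0] using hw.2.2 _ (hcl.frontier_subset ht)
    have hwu : w = ⟪u, w⟫ • u := by
      have h1 : ⟪u, w - ⟪u, w⟫ • u⟫ = 0 := by simp [inner_sub_right, inner_smul_right, hun]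
      have h2 := hperp _ h1
      have h3 : ⟪w - ⟪u, w⟫ • u, w - ⟪u, w⟫ • u⟫ = 0 := by
        rw [inner_sub_left, h2, real_inner_smul_left, h1]; simp
      exact sub_eq_zero.1 (inner_self_eq_zero.1 h3)
    have habs : |⟪u, w⟫| = 1 := by
      have := congrArg norm hwu
      rwa [norm_smul, hun, hw.2.1, mul_one, Real.norm_eq_abs, eq_comm] at this
    rcases (abs_eq zero_le_one).1 habs with h | h
    · rwa [h, one_smul] at hwu
    -- If `-u` were also a normal, `K` would lie in a hyperplane, and its interior points would be
    -- boundary points.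
    · rw [h, neg_one_smul] at hwu
      exfalso
      obtain ⟨z, hz⟩ := hint
      have hzx : ⟪z, u⟫ = ⟪x, u⟫ := by
        refine le_antisymm (hnormal z (interior_subset hz)) ?_
        have := hw.2.2 z (interior_subset hz)
        simpa [hwu] using this
      refine (mem_frontier_of_isMax (u := u) ?_ (interior_subset hz) (hzx ▸ hnormal)).2 hz
      intro h0
      rw [h0] at hun
      simp at hun
  · rintro rfl
    exact ⟨hx, hun, hnormal⟩

theorem gaussMap_eq {K : Set (E n)} {x u : E n} (h : ∀ w, IsOuterUnitNormal K x w ↔ w = u) :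
    gaussMap K x = u := by
  have hex : ∃ w, IsOuterUnitNormal K x w := ⟨u, (h u).2 rfl⟩
  rw [gaussMap, dif_pos hex]
  exact (h _).1 hex.choose_spec

variable {K : ConvexBody (E n)}

theorem IsC2Plus.isOuterUnitNormal_iff (hK : IsC2Plus K) {x : E n}
    (hx : x ∈ frontier (K : Set (E n))) (w : E n) :
    IsOuterUnitNormal (K : Set (E n)) x w ↔ w = gaussMap (K : Set (E n)) x := by
  obtain ⟨u, hu, -⟩ := hK.c2_boundary.exists_normal K.convex K.isClosed hK.nonempty_interior hx
  rw [gaussMap_eq hu, hu]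

theorem IsC2Plus.exists_curve (hK : IsC2Plus K) {x : E n}
    (hx : x ∈ frontier (K : Set (E n))) {v : E n} (hv : ⟪gaussMap (K : Set (E n)) x, v⟫ = 0) :
    ∃ γ : ℝ → E n, γ 0 = x ∧ HasDerivAt γ v 0 ∧ ∀ᶠ t in 𝓝 0, γ t ∈ frontier (K : Set (E n)) := by
  obtain ⟨u, hu, h⟩ := hK.c2_boundary.exists_normal K.convex K.isClosed hK.nonempty_interior hx
  rw [gaussMap_eq hu] at hv
  exact h v hv

/-- The derivative of a function along a set is determined on velocities of curves in the set. -/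
theorem _root_.HasFDerivWithinAt.apply_eq_of_curve {V W : Type*} [NormedAddCommGroup V]
    [NormedSpace ℝ V] [NormedAddCommGroup W] [NormedSpace ℝ W] {f : V → W} {f' : V →L[ℝ] W}
    {s : Set V} {γ : ℝ → V} {v : V} {w : W} (hf : HasFDerivWithinAt f f' s (γ 0))
    (hγ : HasDerivAt γ v 0) (hs : ∀ᶠ t in 𝓝 0, γ t ∈ s)
    (hw : HasDerivAt (fun t => f (γ t)) w 0) : f' v = w := by
  have h1 : HasDerivWithinAt (f ∘ γ) (f' v) (γ ⁻¹' s) 0 :=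
    hf.comp_hasDerivWithinAt 0 hγ.hasDerivWithinAt (fun t ht => ht)
  exact (h1.hasDerivAt hs).unique hw

/-- Two points with the same normal span a segment in `∂K` on which the Gauss map is constant. Its
derivative then kills `y - x`, so the curvature at the midpoint is zero. -/
theorem IsC2Plus.point_unique (hK : IsC2Plus K) {x y u : E n}
    (hx : IsOuterUnitNormal (K : Set (E n)) x u) (hy : IsOuterUnitNormal (K : Set (E n)) y u) :
    x = y := by
  by_contra hne
  have hu0 : u ≠ 0 := by
    rintro rfl
    simpa using hx.2.1
  have hxK := K.isClosed.frontier_subset hx.1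
  have hyK := K.isClosed.frontier_subset hy.1
  have hxy : ⟪x, u⟫ = ⟪y, u⟫ := le_antisymm (hy.2.2 x hxK) (hx.2.2 y hyK)
  let γ : ℝ → E n := fun t => (1 / 2 - t) • x + (1 / 2 + t) • y
  have hγ : HasDerivAt γ (y - x) 0 := by
    have h1 : HasDerivAt γ ((-1 : ℝ) • x + (1 : ℝ) • y) 0 :=
      (((hasDerivAt_id (0 : ℝ)).const_sub (1 / 2)).smul_const x).add
        (((hasDerivAt_id (0 : ℝ)).const_add (1 / 2)).smul_const y)
    rwa [show (-1 : ℝ) • x + (1 : ℝ) • y = y - x by module] at h1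
  have hγu : ∀ t, ⟪γ t, u⟫ = ⟪x, u⟫ := fun t => by
    simp only [γ, inner_add_left, real_inner_smul_left, ← hxy]
    ring
  have hn : ∀ᶠ t in 𝓝 (0 : ℝ), IsOuterUnitNormal (K : Set (E n)) (γ t) u := by
    filter_upwards [Icc_mem_nhds (show (-(1 / 2) : ℝ) < 0 by norm_num)
      (show (0 : ℝ) < 1 / 2 by norm_num)] with t ht
    have hmem : γ t ∈ (K : Set (E n)) :=
      K.convex hxK hyK (by linarith [ht.2]) (by linarith [ht.1]) (by ring)
    have hmax : ∀ z ∈ (K : Set (E n)), ⟪z, u⟫ ≤ ⟪γ t, u⟫ := fun z hz => by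
      rw [hγu]
      exact hx.2.2 z hz
    exact ⟨mem_frontier_of_isMax hu0 hmem hmax, hx.2.1, hmax⟩
  have hm := hn.self_of_nhds
  have hG : gaussMap (K : Set (E n)) (γ 0) = u := ((hK.isOuterUnitNormal_iff hm.1 u).1 hm).symm
  have hpos := hK.curvature_pos _ hm.1
  rw [gaussCurvature, hG, tangentDet_eq_zero (v := y - x)] at hpos
  · exact lt_irrefl _ hpos
  · rw [Submodule.mem_orthogonal_singleton_iff_inner_left, inner_sub_left, hxy, sub_self]
  · exact sub_ne_zero.2 (Ne.symm hne)
  -- Without differentiability the derivative takes the default value zero, which also kills `y -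
  -- x`.
  · by_cases hd : DifferentiableWithinAt ℝ (gaussMap (K : Set (E n))) (frontier K) (γ 0)
    · refine hd.hasFDerivWithinAt.apply_eq_of_curve hγ (hn.mono fun t ht => ht.1) ?_
      refine (hasDerivAt_const (0 : ℝ) u).congr_of_eventuallyEq ?_
      filter_upwards [hn] with t ht
      exact ((hK.isOuterUnitNormal_iff ht.1 u).1 ht).symm
    · rw [fderivWithin_zero_of_not_differentiableWithinAt hd]
      simp

theorem exists_isOuterUnitNormal (K : ConvexBody (E n)) {u : E n} (hu : ‖u‖ = 1) :
    ∃ x, IsOuterUnitNormal (K : Set (E n)) x u := by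
  obtain ⟨x, hx, hmax⟩ := K.isCompact.exists_isMaxOn K.nonempty
    (f := fun x : E n => ⟪x, u⟫) (by fun_prop)
  have h0 : u ≠ 0 := by
    rintro rfl
    simp at hu
  exact ⟨x, mem_frontier_of_isMax h0 hx hmax, hu, hmax⟩

theorem IsC2Plus.curvatureFun_eq (hK : IsC2Plus K) {x u : E n}
    (hx : IsOuterUnitNormal (K : Set (E n)) x u) :
    curvatureFun (K : Set (E n)) u = (gaussCurvature (K : Set (E n)) x)⁻¹ := by
  have h : ∃ x, IsOuterUnitNormal (K : Set (E n)) x u := ⟨x, hx⟩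
  rw [curvatureFun, dif_pos h, hK.point_unique h.choose_spec hx]

end

/-! ### Behaviour of normals, curvature and support functions under a linear map -/

section

variable {n : ℕ} {K : ConvexBody (E n)} (T : E n ≃ₗ[ℝ] E n)

theorem adjoint_symm_adjoint (v : E n) :
    LinearMap.adjoint (T.symm : E n →ₗ[ℝ] E n) (LinearMap.adjoint (T : E n →ₗ[ℝ] E n) v) = v :=
  ext_inner_right ℝ fun w => by simp [LinearMap.adjoint_inner_left]

theorem adjoint_adjoint_symm (v : E n) :
    LinearMap.adjoint (T : E n →ₗ[ℝ] E n) (LinearMap.adjoint (T.symm : E n →ₗ[ℝ] E n) v) = v :=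
  adjoint_symm_adjoint T.symm v

/-- The adjoint of a linear automorphism, as a linear automorphism. -/
def adjointEquiv : E n ≃ₗ[ℝ] E n :=
  LinearEquiv.ofLinearMap (LinearMap.adjoint (T : E n →ₗ[ℝ] E n))
    (LinearMap.adjoint (T.symm : E n →ₗ[ℝ] E n))
    (LinearMap.ext (adjoint_adjoint_symm T)) (LinearMap.ext (adjoint_symm_adjoint T))

theorem coe_adjointEquiv :
    (adjointEquiv T : E n →ₗ[ℝ] E n) = LinearMap.adjoint (T : E n →ₗ[ℝ] E n) := rfl

theorem adjointEquiv_apply (v : E n) :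
    adjointEquiv T v = LinearMap.adjoint (T : E n →ₗ[ℝ] E n) v := rfl

theorem adjointEquiv_inner (v w : E n) : ⟪adjointEquiv T v, w⟫ = ⟪v, T w⟫ :=
  LinearMap.adjoint_inner_left _ _ _

/-- The radial projection of a vector to the unit sphere. -/
def normalize (v : E n) : E n := ‖v‖⁻¹ • v

theorem norm_normalize {v : E n} (hv : v ≠ 0) : ‖normalize v‖ = 1 := by
  simp [normalize, norm_smul, hv]

theorem normalize_of_norm_eq_one {v : E n} (hv : ‖v‖ = 1) : normalize v = v := by
  simp [normalize, hv]

theorem normalize_smul {c : ℝ} (hc : 0 < c) (v : E n) : normalize (c • v) = normalize v := by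
  simp only [normalize, norm_smul, Real.norm_eq_abs, abs_of_pos hc, mul_inv, smul_smul]
  rw [mul_right_comm, inv_mul_cancel₀ hc.ne', one_mul]

theorem normalize_map_normalize (L : E n ≃ₗ[ℝ] E n) {v : E n} (hv : v ≠ 0) :
    normalize (L (normalize v)) = normalize (L v) := by
  rw [show normalize v = ‖v‖⁻¹ • v from rfl, map_smul, normalize_smul (by positivity)]

theorem normalize_symm_normalize (L : E n ≃ₗ[ℝ] E n) {v : E n} (hv : ‖v‖ = 1) :
    normalize (L.symm (normalize (L v))) = v := by
  have hv0 : L v ≠ 0 := by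
    intro h
    rw [L.map_eq_zero_iff] at h
    simp [h] at hv
  rw [normalize_map_normalize _ hv0, L.symm_apply_apply, normalize_of_norm_eq_one hv]

/-- The functional `L` is left unspecified: its contribution is a multiple of `q`, which the
projection onto `q^⊥` removes. -/
theorem hasFDerivAt_normalize {q : E n} (hq : q ≠ 0) :
    ∃ L : E n →L[ℝ] ℝ,
      HasFDerivAt normalize (‖q‖⁻¹ • ContinuousLinearMap.id ℝ (E n) + L.smulRight q) q := by
  have h : DifferentiableAt ℝ (fun v : E n => ‖v‖⁻¹) q :=
    (differentiableAt_id.norm ℝ hq).inv (norm_ne_zero_iff.2 hq)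
  exact ⟨_, h.hasFDerivAt.smul (hasFDerivAt_id q)⟩

theorem frontier_image (K : Set (E n)) : frontier (T '' K) = T '' frontier K :=
  (T.toContinuousLinearEquiv.toHomeomorph.image_frontier K).symm

theorem isOuterUnitNormal_image_iff (K : Set (E n)) (x : E n) {u : E n} (hu : ‖u‖ = 1) :
    IsOuterUnitNormal (T '' K) (T x) u ↔ IsOuterUnitNormal K x (normalize (adjointEquiv T u)) := by
  have h0 : adjointEquiv T u ≠ 0 := by
    intro h
    rw [LinearEquiv.map_eq_zero_iff] at h
    simp [h] at hu
  have hpos : 0 < ‖adjointEquiv T u‖⁻¹ := by positivity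
  have hin : ∀ y, ⟪y, normalize (adjointEquiv T u)⟫ = ‖adjointEquiv T u‖⁻¹ * ⟪T y, u⟫ := by
    intro y
    rw [normalize, real_inner_smul_right, real_inner_comm, adjointEquiv_inner, real_inner_comm]
  simp only [IsOuterUnitNormal, frontier_image, T.injective.mem_set_image, hu, norm_normalize h0,
    Set.forall_mem_image, hin, mul_le_mul_iff_right₀ hpos]

theorem IsC2Plus.isOuterUnitNormal_image (hK : IsC2Plus K) {x : E n}
    (hx : x ∈ frontier (K : Set (E n))) (w : E n) :
    IsOuterUnitNormal (T '' (K : Set (E n))) (T x) w ↔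
      w = normalize ((adjointEquiv T).symm (gaussMap (K : Set (E n)) x)) := by
  have hN := (hK.isOuterUnitNormal_iff hx _).2 rfl
  have h0 : (adjointEquiv T).symm (gaussMap (K : Set (E n)) x) ≠ 0 := by
    intro h
    rw [LinearEquiv.map_eq_zero_iff] at h
    simpa [h] using hN.2.1
  constructor
  · intro hw
    have h1 := (isOuterUnitNormal_image_iff T (K : Set (E n)) x hw.2.1).1 hw
    rw [← (hK.isOuterUnitNormal_iff hx _).1 h1, normalize_symm_normalize _ hw.2.1]
  · rintro rfl
    rw [isOuterUnitNormal_image_iff T _ x (norm_normalize h0)]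
    have h2 := normalize_symm_normalize (adjointEquiv T).symm hN.2.1
    rw [LinearEquiv.symm_symm] at h2
    rwa [h2]

theorem IsC2Plus.gaussMap_image (hK : IsC2Plus K) {x : E n}
    (hx : x ∈ frontier (K : Set (E n))) :
    gaussMap (T '' (K : Set (E n))) (T x) =
      normalize ((adjointEquiv T).symm (gaussMap (K : Set (E n)) x)) :=
  gaussMap_eq (hK.isOuterUnitNormal_image T hx)

theorem IsC2Plus.gaussCurvature_image (hK : IsC2Plus K) {x u : E n} (hu : ‖u‖ = 1)
    (hx : IsOuterUnitNormal (K : Set (E n)) x (normalize (adjointEquiv T u))) :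
    gaussCurvature (T '' (K : Set (E n))) (T x) =
      ‖adjointEquiv T u‖ ^ (n + 1) / LinearMap.det (T : E n →ₗ[ℝ] E n) ^ 2 *
        gaussCurvature (K : Set (E n)) x := by
  have hxf := hx.1
  have hN := (hK.isOuterUnitNormal_iff hxf _).1 hx
  have hpos := hK.curvature_pos x hxf
  have hG : gaussMap (T '' (K : Set (E n))) (T x) = u := by
    rw [hK.gaussMap_image T hxf, ← hN, normalize_symm_normalize _ hu]
  set b := ‖adjointEquiv T u‖ with hb
  have hb0 : 0 < b := by
    refine norm_pos_iff.2 fun h => ?_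
    rw [LinearEquiv.map_eq_zero_iff] at h
    simp [h] at hu
  set S := (adjointEquiv T).symm with hS
  have hRu : LinearMap.adjoint (T : E n →ₗ[ℝ] E n) u = b • gaussMap (K : Set (E n)) x := by
    rw [← hN, normalize, smul_smul, mul_inv_cancel₀ hb0.ne', one_smul]
    rfl
  have hSN : S (gaussMap (K : Set (E n)) x) = b⁻¹ • u := by
    rw [← hN, normalize, map_smul, LinearEquiv.symm_apply_apply]
  have hSN0 : S (gaussMap (K : Set (E n)) x) ≠ 0 := by
    rw [hSN]
    refine smul_ne_zero (inv_ne_zero hb0.ne') ?_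
    rintro rfl
    simp at hu
  have hSNn : ‖S (gaussMap (K : Set (E n)) x)‖⁻¹ = b := by
    rw [hSN, norm_smul, hu, Real.norm_eq_abs, abs_of_pos (inv_pos.2 hb0), mul_one, inv_inv]
  set D := fderivWithin ℝ (gaussMap (K : Set (E n))) (frontier K) x with hD
  let M : E n →L[ℝ] E n :=
    S.toContinuousLinearEquiv.toContinuousLinearMap ∘L D ∘L
      T.symm.toContinuousLinearEquiv.toContinuousLinearMap
  have hM : ∀ v, M v = S (D (T.symm v)) := fun v => rfl
  have hmain : tangentDet u (fderivWithin ℝ (gaussMap (T '' (K : Set (E n))))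
      (frontier (T '' (K : Set (E n)))) (T x)) = tangentDet u (b • M) := by
    refine tangentDet_congr _ _ fun v hv => ?_
    rcases eq_or_ne v 0 with rfl | hv0
    -- The zero vector is separated off because for `n = 1` the tangent space is trivial and
    -- positive curvature does not force differentiability. A nonzero tangent vector does force it,
    -- since the default derivative zero would give zero curvature.
    · simp
    have hw0 : T.symm v ≠ 0 := fun h => hv0 (T.symm.map_eq_zero_iff.1 h)
    have hw : ⟪gaussMap (K : Set (E n)) x, T.symm v⟫ = 0 := by
      have h1 : ⟪b • gaussMap (K : Set (E n)) x, T.symm v⟫ = 0 := by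
        rw [← hRu, ← adjointEquiv_apply, adjointEquiv_inner, LinearEquiv.apply_symm_apply]
        exact Submodule.mem_orthogonal_singleton_iff_inner_right.1 hv
      rw [real_inner_smul_left] at h1
      exact (mul_eq_zero.1 h1).resolve_left hb0.ne'
    have hdiff : DifferentiableWithinAt ℝ (gaussMap (K : Set (E n))) (frontier K) x := by
      by_contra hnd
      have h0 := fderivWithin_zero_of_not_differentiableWithinAt hnd
      rw [gaussCurvature, h0, tangentDet_eq_zero _
        (Submodule.mem_orthogonal_singleton_iff_inner_right.2 hw) hw0 (by simp)] at hpos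
      exact lt_irrefl _ hpos
    obtain ⟨γ, hγ0, hγ, hγf⟩ := hK.exists_curve hxf hw
    obtain ⟨L, hL⟩ := hasFDerivAt_normalize hSN0
    have hNγ : HasDerivAt (fun t => gaussMap (K : Set (E n)) (γ t)) (D (T.symm v)) 0 := by
      have h1 : HasFDerivWithinAt (gaussMap (K : Set (E n))) D (frontier K) (γ 0) := by
        rw [hγ0]
        exact hdiff.hasFDerivWithinAt
      have h2 : HasDerivWithinAt (gaussMap (K : Set (E n)) ∘ γ) (D (T.symm v))
          (γ ⁻¹' frontier K) 0 :=
        h1.comp_hasDerivWithinAt 0 hγ.hasDerivWithinAt (fun t ht => ht)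
      exact h2.hasDerivAt hγf
    have hSNγ : HasDerivAt (fun t => S (gaussMap (K : Set (E n)) (γ t))) (M v) 0 :=
      S.toContinuousLinearEquiv.hasFDerivAt.comp_hasDerivAt (0 : ℝ) hNγ
    have hnorm : HasDerivAt (fun t => gaussMap (T '' (K : Set (E n))) (T (γ t)))
        (b • M v + L (M v) • S (gaussMap (K : Set (E n)) x)) 0 := by
      rw [← hγ0] at hL
      have h1 := hL.comp_hasDerivAt (0 : ℝ) hSNγ
      rw [hγ0, hSNn] at h1
      refine HasDerivAt.congr_of_eventuallyEq (f := fun t =>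
        normalize (S (gaussMap (K : Set (E n)) (γ t)))) h1 ?_
      filter_upwards [hγf] with t ht
      exact hK.gaussMap_image T ht
    have hTγ : HasDerivAt (fun t => T (γ t)) v 0 := by
      have h1 : HasDerivAt (fun t => T (γ t)) (T (T.symm v)) 0 :=
        T.toContinuousLinearEquiv.hasFDerivAt.comp_hasDerivAt (0 : ℝ) hγ
      rwa [T.apply_symm_apply] at h1
    have hdiffT : DifferentiableWithinAt ℝ (gaussMap (T '' (K : Set (E n))))
        (frontier (T '' (K : Set (E n)))) (T x) := by
      have h1 : DifferentiableWithinAt ℝ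
          (fun z => normalize (S (gaussMap (K : Set (E n)) (T.symm z))))
          (frontier (T '' (K : Set (E n)))) (T x) := by
        have h2 : DifferentiableWithinAt ℝ (gaussMap (K : Set (E n))) (frontier K)
            (T.symm (T x)) := by rwa [T.symm_apply_apply]
        have h3 : DifferentiableWithinAt ℝ (fun z => gaussMap (K : Set (E n)) (T.symm z))
            (frontier (T '' (K : Set (E n)))) (T x) := by
          refine h2.comp (T x) (f := fun z => T.symm z)
            T.symm.toContinuousLinearEquiv.differentiableAt.differentiableWithinAt ?_
          rw [frontier_image]
          rintro _ ⟨y, hy, rfl⟩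
          simpa using hy
        have h4 : DifferentiableWithinAt ℝ (fun z => S (gaussMap (K : Set (E n)) (T.symm z)))
            (frontier (T '' (K : Set (E n)))) (T x) :=
          S.toContinuousLinearEquiv.differentiableAt.comp_differentiableWithinAt (T x) h3
        refine DifferentiableAt.comp_differentiableWithinAt (T x) (g := normalize) ?_ h4
        rw [T.symm_apply_apply]
        exact hL.differentiableAt
      refine h1.congr ?_ ?_
      · rw [frontier_image]
        rintro _ ⟨y, hy, rfl⟩
        rw [hK.gaussMap_image T hy, T.symm_apply_apply]
      · rw [hK.gaussMap_image T hxf, T.symm_apply_apply]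
    have hval := HasFDerivWithinAt.apply_eq_of_curve (γ := fun t => T (γ t))
      (by rw [hγ0]; exact hdiffT.hasFDerivWithinAt) hTγ
      (hγf.mono fun t ht => by rw [frontier_image]; exact ⟨_, ht, rfl⟩) hnorm
    rw [hval, hSN, map_add, map_smul, map_smul, map_smul,
      Submodule.orthogonalProjectionOnto_orthogonalComplement_singleton_eq_zero]
    simp
  -- Makes the subtraction in `b ^ (n - 1)` genuine; together with `b ^ 2` from `tangentDet_conj` it
  -- gives `b ^ (n + 1)`.
  obtain ⟨k, rfl⟩ : ∃ k, n = k + 1 := ⟨_, (finrank_orthogonal_singleton hu).symm⟩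
  rw [gaussCurvature, hG, hmain, tangentDet_smul hu,
    tangentDet_conj (hN ▸ hx.2.1) hu T hRu D M hM, gaussCurvature, Nat.add_sub_cancel]
  ring

theorem IsC2Plus.curvatureFun_image (hK : IsC2Plus K) {u : E n} (hu : ‖u‖ = 1) :
    curvatureFun (T '' (K : Set (E n))) u =
      LinearMap.det (T : E n →ₗ[ℝ] E n) ^ 2 / ‖adjointEquiv T u‖ ^ (n + 1) *
        curvatureFun (K : Set (E n)) (normalize (adjointEquiv T u)) := by
  have h0 : adjointEquiv T u ≠ 0 := by
    intro h
    rw [LinearEquiv.map_eq_zero_iff] at h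
    simp [h] at hu
  have hex : ∃ z, IsOuterUnitNormal (T '' (K : Set (E n))) z u := by
    obtain ⟨x, hx⟩ := exists_isOuterUnitNormal K (norm_normalize h0)
    exact ⟨T x, (isOuterUnitNormal_image_iff T _ x hu).2 hx⟩
  have hz := hex.choose_spec
  rw [curvatureFun, dif_pos hex]
  set z := hex.choose
  -- The chosen point is pulled back to `K`, so that uniqueness is invoked for `K` and never for its
  -- image.
  obtain ⟨x, -, hxz⟩ : z ∈ T '' frontier (K : Set (E n)) := frontier_image T _ ▸ hz.1
  rw [← hxz] at hz ⊢
  have hx := (isOuterUnitNormal_image_iff T _ x hu).1 hz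
  rw [hK.gaussCurvature_image T hu hx, hK.curvatureFun_eq hx, mul_inv, inv_div]

theorem supportFun_image (K : Set (E n)) (u : E n) :
    supportFun (T '' K) u = supportFun K (adjointEquiv T u) := by
  rw [supportFun, supportFun, Set.image_image]
  congr 1
  refine Set.image_congr fun x _ => ?_
  rw [real_inner_comm, ← adjointEquiv_inner, real_inner_comm]

theorem supportFun_smul (K : Set (E n)) {c : ℝ} (hc : 0 ≤ c) (u : E n) :
    supportFun K (c • u) = c * supportFun K u := by
  rw [supportFun, supportFun, ← smul_eq_mul, ← Real.sSup_smul_of_nonneg hc, ← Set.image_smul,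
    Set.image_image]
  simp only [real_inner_smul_right, smul_eq_mul]

theorem supportFun_image_eq (K : Set (E n)) {u : E n} (hu : ‖u‖ = 1) :
    supportFun (T '' K) u =
      ‖adjointEquiv T u‖ * supportFun K (normalize (adjointEquiv T u)) := by
  have h0 : adjointEquiv T u ≠ 0 := by
    intro h
    rw [LinearEquiv.map_eq_zero_iff] at h
    simp [h] at hu
  rw [supportFun_image, ← supportFun_smul K (norm_nonneg _), normalize, smul_smul,
    mul_inv_cancel₀ (norm_ne_zero_iff.2 h0), one_smul]

theorem supportFun_nonneg (K : ConvexBody (E n)) (h0 : (0 : E n) ∈ K) (u : E n) :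
    0 ≤ supportFun (K : Set (E n)) u := by
  refine le_csSup (K.isCompact.image (by fun_prop)).bddAbove ⟨0, h0, by simp⟩

theorem IsC2Plus.curvatureFun_nonneg (hK : IsC2Plus K) {u : E n} (hu : ‖u‖ = 1) :
    0 ≤ curvatureFun (K : Set (E n)) u := by
  obtain ⟨x, hx⟩ := exists_isOuterUnitNormal K hu
  rw [hK.curvatureFun_eq hx]
  exact (inv_pos.2 (hK.curvature_pos x hx.1)).le

/-- The average over a closed convex set of positive finite measure lies in the set. This makes the
support functions nonnegative, as the real powers require. -/
theorem IsC2Plus.zero_mem (hK : IsC2Plus K) (hc : centroid (K : Set (E n)) = 0) :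
    (0 : E n) ∈ K := by
  have h := K.convex.set_average_mem (μ := volume) (t := (K : Set (E n))) (f := fun x => x)
    K.isClosed (((measure_mono interior_subset).trans_lt'
      (isOpen_interior.measure_pos volume hK.nonempty_interior)).ne')
    K.isCompact.measure_lt_top.ne (ae_restrict_mem K.isClosed.measurableSet)
    (continuousOn_id.integrableOn_compact K.isCompact)
  rw [← hc]
  exact h

end

/-! ### Change of variables on the sphere -/

section

variable {n : ℕ}

theorem map_sphere_ne_zero (L : E n ≃ₗ[ℝ] E n) (u : sphere (0 : E n) 1) : L u ≠ 0 := by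
  rw [Ne, LinearEquiv.map_eq_zero_iff]
  exact ne_zero_of_mem_unit_sphere u

theorem continuous_normalize_map (L : E n ≃ₗ[ℝ] E n) :
    Continuous fun u : sphere (0 : E n) 1 => normalize (L u) := by
  have hL : Continuous fun u : sphere (0 : E n) 1 => L u :=
    L.toContinuousLinearEquiv.continuous.comp continuous_subtype_val
  exact (hL.norm.inv₀ fun u => norm_ne_zero_iff.2 (map_sphere_ne_zero L u)).smul hL

theorem normalize_map_mem_sphere (L : E n ≃ₗ[ℝ] E n) (u : sphere (0 : E n) 1) :
    normalize (L u) ∈ sphere (0 : E n) 1 :=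
  mem_sphere_zero_iff_norm.2 (norm_normalize (map_sphere_ne_zero L u))

/-- The homeomorphism `u ↦ L u / ‖L u‖` of the unit sphere. -/
def sphereHomeomorph (L : E n ≃ₗ[ℝ] E n) : sphere (0 : E n) 1 ≃ₜ sphere (0 : E n) 1 where
  toFun u := ⟨normalize (L u), normalize_map_mem_sphere L u⟩
  invFun u := ⟨normalize (L.symm u), normalize_map_mem_sphere L.symm u⟩
  left_inv u := Subtype.ext (normalize_symm_normalize L (mem_sphere_zero_iff_norm.1 u.2))
  right_inv u := Subtype.ext (normalize_symm_normalize L.symm (mem_sphere_zero_iff_norm.1 u.2))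
  continuous_toFun := (continuous_normalize_map L).subtype_mk _
  continuous_invFun := (continuous_normalize_map L.symm).subtype_mk _

theorem coe_sphereHomeomorph (L : E n ≃ₗ[ℝ] E n) (u : sphere (0 : E n) 1) :
    (sphereHomeomorph L u : E n) = normalize (L u) := rfl

/-- The set of nonzero points of direction in `s` and of norm less than the radial function `ρ`. -/
def radialSet (s : Set (sphere (0 : E n) 1)) (ρ : sphere (0 : E n) 1 → ℝ) : Set (E n) :=
  (↑) '' {z : ({0}ᶜ : Set (E n)) | (homeomorphUnitSphereProd (E n) z).1 ∈ s ∧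
    ‖(z : E n)‖ < ρ (homeomorphUnitSphereProd (E n) z).1}

/-- Polar coordinates: the ray in direction `u` contributes the integral of `r^(n-1)` over `(0, ρ
u)`. -/
theorem volume_radialSet (hn : 1 ≤ n) {s : Set (sphere (0 : E n) 1)} (hs : MeasurableSet s)
    {ρ : sphere (0 : E n) 1 → ℝ} (hρ : Measurable ρ) (hpos : ∀ u, 0 < ρ u) :
    volume (radialSet s ρ) =
      ∫⁻ u in s, ENNReal.ofReal (ρ u ^ n / n) ∂(volume : Measure (E n)).toSphere := by
  set P : Set (sphere (0 : E n) 1 × Set.Ioi (0 : ℝ)) := {p | p.1 ∈ s ∧ (p.2 : ℝ) < ρ p.1} with hP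
  have hPm : MeasurableSet P :=
    (measurable_fst hs).inter
      (measurableSet_lt (measurable_subtype_coe.comp measurable_snd) (hρ.comp measurable_fst))
  have hpre : radialSet s ρ = (↑) '' (homeomorphUnitSphereProd (E n) ⁻¹' P) := by
    simp [radialSet, hP, Set.preimage]
  rw [hpre, ← comap_subtype_coe_apply (measurableSet_singleton _).compl,
    (volume : Measure (E n)).measurePreserving_homeomorphUnitSphereProd.measure_preimage
      hPm.nullMeasurableSet, Measure.prod_apply hPm, ← lintegral_indicator hs]
  refine lintegral_congr fun u => ?_
  by_cases hu : u ∈ s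
  · have hsec : Prod.mk u ⁻¹' P = Set.Iio (⟨ρ u, hpos u⟩ : Set.Ioi (0 : ℝ)) := by
      ext r
      simp [hP, hu, ← Subtype.coe_lt_coe]
    rw [hsec, Measure.volumeIoiPow_apply_Iio, Set.indicator_of_mem hu, finrank_euclideanSpace_fin,
      ← Nat.cast_add_one, Nat.sub_add_cancel hn]
  · have hsec : Prod.mk u ⁻¹' P = ∅ := by
      ext r
      simp [hP, hu]
    rw [hsec, measure_empty, Set.indicator_of_notMem hu]

theorem preimage_radialSet (L : E n ≃ₗ[ℝ] E n) (s : Set (sphere (0 : E n) 1)) :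
    L ⁻¹' radialSet s (fun _ => 1) =
      radialSet (sphereHomeomorph L ⁻¹' s) (fun u => ‖L u‖⁻¹) := by
  ext z
  rcases eq_or_ne z 0 with rfl | hz
  · simp [radialSet]
  have hLz : L z ≠ 0 := by rwa [Ne, LinearEquiv.map_eq_zero_iff]
  have hdir : sphereHomeomorph L (homeomorphUnitSphereProd (E n) ⟨z, hz⟩).1 =
      (homeomorphUnitSphereProd (E n) ⟨L z, hLz⟩).1 := by
    apply Subtype.ext
    rw [coe_sphereHomeomorph, homeomorphUnitSphereProd_apply_fst_coe,
      homeomorphUnitSphereProd_apply_fst_coe]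
    exact normalize_map_normalize L hz
  have hzn : 0 < ‖z‖ := norm_pos_iff.2 hz
  have hnorm : ‖z‖ < ‖L (homeomorphUnitSphereProd (E n) ⟨z, hz⟩).1‖⁻¹ ↔ ‖L z‖ < 1 := by
    rw [homeomorphUnitSphereProd_apply_fst_coe, map_smul, norm_smul, norm_inv, norm_norm, mul_inv,
      inv_inv, lt_mul_iff_one_lt_right hzn, one_lt_inv₀ (norm_pos_iff.2 hLz)]
  have hmem : ∀ (t : Set (sphere (0 : E n) 1)) (ρ : sphere (0 : E n) 1 → ℝ) (w : E n)
      (hw : w ≠ 0), w ∈ radialSet t ρ ↔ (homeomorphUnitSphereProd (E n) ⟨w, hw⟩).1 ∈ t ∧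
        ‖w‖ < ρ (homeomorphUnitSphereProd (E n) ⟨w, hw⟩).1 := by
    intro t ρ w hw
    constructor
    · rintro ⟨⟨w', hw'⟩, h, rfl⟩
      exact h
    · exact fun h => ⟨⟨w, hw⟩, h, rfl⟩
  rw [Set.mem_preimage, hmem _ _ _ hLz, hmem _ _ _ hz, Set.mem_preimage, hdir, hnorm]

/-- The density of the pullback of the surface area measure under `sphereHomeomorph L`, up to the
factor `|det L|`. -/
def sphereDensity (L : E n ≃ₗ[ℝ] E n) (u : sphere (0 : E n) 1) : NNReal :=
  Real.toNNReal ((‖L u‖ ^ n)⁻¹)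

theorem continuous_norm_map (L : E n ≃ₗ[ℝ] E n) :
    Continuous fun u : sphere (0 : E n) 1 => ‖L u‖ :=
  (L.toContinuousLinearEquiv.continuous.comp continuous_subtype_val).norm

theorem measurable_sphereDensity (L : E n ≃ₗ[ℝ] E n) : Measurable (sphereDensity L) :=
  ((continuous_norm_map L).measurable.pow_const n).inv.real_toNNReal

/-- The volume of the `L`-preimage of the unit cone over `s` is computed twice: by linear scaling,
and in polar coordinates with radial function `‖L u‖⁻¹`. The common factor `1/n` cancels. -/
theorem map_withDensity_sphereHomeomorph (hn : 1 ≤ n) (L : E n ≃ₗ[ℝ] E n) :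
    ((volume : Measure (E n)).toSphere.withDensity fun u => (sphereDensity L u : ENNReal)).map
        (sphereHomeomorph L) =
      ENNReal.ofReal |LinearMap.det (L.symm : E n →ₗ[ℝ] E n)| •
        (volume : Measure (E n)).toSphere := by
  have hn0 : (0 : ℝ) < n := by exact_mod_cast hn
  ext s hs
  have hs' := (sphereHomeomorph L).measurable hs
  rw [Measure.map_apply (sphereHomeomorph L).measurable hs, withDensity_apply _ hs',
    Measure.smul_apply, smul_eq_mul]
  have h1 := volume_radialSet hn hs (ρ := fun _ => 1) measurable_const (fun _ => one_pos)
  have h2 := volume_radialSet hn hs' (ρ := fun u => ‖L u‖⁻¹)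
    (continuous_norm_map L).measurable.inv
    (fun u => inv_pos.2 (norm_pos_iff.2 (map_sphere_ne_zero L u)))
  rw [← preimage_radialSet, Measure.addHaar_preimage_linearEquiv, h1] at h2
  have h3 : ∀ u : sphere (0 : E n) 1, ENNReal.ofReal (‖L u‖⁻¹ ^ n / n) =
      (sphereDensity L u : ENNReal) * ENNReal.ofReal ((n : ℝ)⁻¹) := fun u => by
    rw [div_eq_mul_inv, ENNReal.ofReal_mul (by positivity), inv_pow]
    rfl
  simp only [h3] at h2
  rw [lintegral_mul_const _ (measurable_sphereDensity L).coe_nnreal_ennreal, setLIntegral_const,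
    one_pow, one_div, mul_comm (ENNReal.ofReal (n : ℝ)⁻¹), ← mul_assoc] at h2
  refine ((ENNReal.mul_left_inj ?_ ENNReal.ofReal_ne_top).1 h2).symm
  exact (ENNReal.ofReal_pos.2 (inv_pos.2 hn0)).ne'

/-- Change of variables `u ↦ L u / ‖L u‖` on the unit sphere. -/
theorem integral_sphere_comp_normalize (hn : 1 ≤ n) (L : E n ≃ₗ[ℝ] E n) (g : E n → ℝ) :
    ∫ u : sphere (0 : E n) 1, (‖L u‖ ^ n)⁻¹ * g (normalize (L u))
        ∂(volume : Measure (E n)).toSphere =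
      |LinearMap.det (L : E n →ₗ[ℝ] E n)|⁻¹ *
        ∫ u : sphere (0 : E n) 1, g u ∂(volume : Measure (E n)).toSphere := by
  -- Transport along a measurable embedding needs neither measurability nor integrability of `g`.
  have h1 := (sphereHomeomorph L).measurableEmbedding.integral_map
    (μ := (volume : Measure (E n)).toSphere.withDensity fun u => (sphereDensity L u : ENNReal))
    (fun u => g u)
  rw [map_withDensity_sphereHomeomorph hn, integral_smul_measure,
    integral_withDensity_eq_integral_smul (measurable_sphereDensity L),
    ENNReal.toReal_ofReal (abs_nonneg _), LinearEquiv.det_coe_symm, abs_inv, smul_eq_mul] at h1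
  rw [h1]
  refine integral_congr_ae (Eventually.of_forall fun u => ?_)
  simp only [sphereDensity, NNReal.smul_def, smul_eq_mul, coe_sphereHomeomorph]
  rw [Real.coe_toNNReal _ (by positivity)]

end

/-! ### Transformation of the mixed affine surface areas -/

section

variable {n : ℕ} {K : Fin n → ConvexBody (E n)}

theorem mixedAffineSurfaceArea_image (hn : 1 ≤ n) (hK : ∀ i, IsC2Plus (K i))
    (h0 : ∀ i, (0 : E n) ∈ K i) (T : E n ≃ₗ[ℝ] E n) {p : ℝ} (hp : p ≠ -(n : ℝ)) :
    mixedAffineSurfaceArea p (fun i => T '' (K i : Set (E n))) =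
      |LinearMap.det (T : E n →ₗ[ℝ] E n)| ^ (((n : ℝ) - p) / ((n : ℝ) + p)) *
        mixedAffineSurfaceArea p (fun i => (K i : Set (E n))) := by
  have hnp : (n : ℝ) + p ≠ 0 := fun h => hp (by linarith)
  set d := |LinearMap.det (T : E n →ₗ[ℝ] E n)| with hd
  have hdpos : 0 < d := abs_pos.2 (LinearEquiv.isUnit_det' T).ne_zero
  have hdsq : LinearMap.det (T : E n →ₗ[ℝ] E n) ^ 2 = d ^ 2 := (sq_abs _).symm
  set g : E n → ℝ := fun u =>
    (∏ i, supportFun (K i : Set (E n)) u ^ (1 - p) * curvatureFun (K i : Set (E n)) u) ^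
      (1 / ((n : ℝ) + p)) with hg
  have hint : ∀ u : sphere (0 : E n) 1,
      (∏ i, supportFun (T '' (K i : Set (E n))) u ^ (1 - p) *
        curvatureFun (T '' (K i : Set (E n))) u) ^ (1 / ((n : ℝ) + p)) =
      d ^ (2 * (n : ℝ) / ((n : ℝ) + p)) *
        ((‖adjointEquiv T u‖ ^ n)⁻¹ * g (normalize (adjointEquiv T u))) := by
    intro u
    have hu : ‖(u : E n)‖ = 1 := mem_sphere_zero_iff_norm.1 u.2
    have hv := map_sphere_ne_zero (adjointEquiv T) u
    set b := ‖adjointEquiv T u‖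
    have hb : 0 < b := norm_pos_iff.2 hv
    set v := normalize (adjointEquiv T u)
    have hv1 : ‖v‖ = 1 := norm_normalize hv
    -- The support function gives `b^(1-p)` and the curvature function `b^(-(n+1))`. The total
    -- exponent `-(n+p)` is what the outer power `1/(n+p)` cancels.
    have hfac : ∀ i, supportFun (T '' (K i : Set (E n))) u ^ (1 - p) *
        curvatureFun (T '' (K i : Set (E n))) u =
        (d ^ (2 : ℝ) * b ^ (-((n : ℝ) + p))) *
          (supportFun (K i : Set (E n)) v ^ (1 - p) * curvatureFun (K i : Set (E n)) v) := by
      intro i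
      have hpow : b ^ (-((n : ℝ) + p)) = b ^ (1 - p) / b ^ (n + 1) := by
        rw [← Real.rpow_natCast, ← Real.rpow_sub hb]
        congr 1
        push_cast
        ring
      rw [supportFun_image_eq T _ hu, (hK i).curvatureFun_image T hu, hdsq,
        Real.mul_rpow hb.le (supportFun_nonneg _ (h0 i) _), hpow, Real.rpow_two]
      ring
    -- Nonnegativity lets the outer real power split over the product.
    have hG : 0 ≤ ∏ i, supportFun (K i : Set (E n)) v ^ (1 - p) *
        curvatureFun (K i : Set (E n)) v :=
      Finset.prod_nonneg fun i _ => mul_nonneg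
        (Real.rpow_nonneg (supportFun_nonneg _ (h0 i) _) _) ((hK i).curvatureFun_nonneg hv1)
    rw [Finset.prod_congr rfl fun i _ => hfac i, Finset.prod_mul_distrib, Finset.prod_const,
      Finset.card_univ, Fintype.card_fin, Real.mul_rpow (by positivity) hG, ← mul_assoc]
    congr 1
    rw [mul_pow, Real.mul_rpow (by positivity) (by positivity), ← Real.rpow_mul_natCast hdpos.le,
      ← Real.rpow_mul_natCast hb.le, ← Real.rpow_mul hdpos.le, ← Real.rpow_mul hb.le,
      ← Real.rpow_natCast b n, ← Real.rpow_neg hb.le]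
    congr 2
    · ring
    · field_simp
  unfold mixedAffineSurfaceArea
  rw [integral_congr_ae (Eventually.of_forall hint), integral_const_mul,
    integral_sphere_comp_normalize hn, coe_adjointEquiv, det_adjoint, ← hd, ← mul_assoc]
  congr 1
  rw [← Real.rpow_neg_one, ← Real.rpow_add hdpos]
  congr 1
  field_simp
  ring

theorem mixedAffineSurfaceAreaInfty_image (hn : 1 ≤ n) (K : Fin n → Set (E n))
    (T : E n ≃ₗ[ℝ] E n) :
    mixedAffineSurfaceAreaInfty (fun i => T '' K i) =
      |LinearMap.det (T : E n →ₗ[ℝ] E n)|⁻¹ * mixedAffineSurfaceAreaInfty K := by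
  have hint : ∀ u : sphere (0 : E n) 1, ∏ i, 1 / supportFun (T '' K i) u =
      (‖adjointEquiv T u‖ ^ n)⁻¹ *
        ∏ i, 1 / supportFun (K i) (normalize (adjointEquiv T u)) := by
    intro u
    have hu : ‖(u : E n)‖ = 1 := mem_sphere_zero_iff_norm.1 u.2
    simp only [supportFun_image_eq T _ hu, one_div, mul_inv, Finset.prod_mul_distrib,
      Finset.prod_const, Finset.card_univ, Fintype.card_fin, inv_pow]
  unfold mixedAffineSurfaceAreaInfty
  rw [integral_congr_ae (Eventually.of_forall hint),
    integral_sphere_comp_normalize hn (adjointEquiv T) (fun v => ∏ i, 1 / supportFun (K i) v),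
    coe_adjointEquiv, det_adjoint]

end

end

end MixedAffine

theorem mainTheorem9 (n : ℕ) (hn : 1 ≤ n)
    (K : Fin n → ConvexBody (EuclideanSpace ℝ (Fin n)))
    (hK : ∀ i, MixedAffine.IsC2Plus (K i))
    (hcent : ∀ i, MixedAffine.centroid (K i : Set (EuclideanSpace ℝ (Fin n))) = 0)
    (T : EuclideanSpace ℝ (Fin n) ≃ₗ[ℝ] EuclideanSpace ℝ (Fin n)) :
    (∀ p : ℝ, p ≠ -(n : ℝ) →
      MixedAffine.mixedAffineSurfaceArea p
          (fun i => T '' (K i : Set (EuclideanSpace ℝ (Fin n)))) =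
        |LinearMap.det (T : EuclideanSpace ℝ (Fin n) →ₗ[ℝ] EuclideanSpace ℝ (Fin n))|
            ^ (((n : ℝ) - p) / ((n : ℝ) + p)) *
          MixedAffine.mixedAffineSurfaceArea p
            (fun i => (K i : Set (EuclideanSpace ℝ (Fin n))))) ∧
    MixedAffine.mixedAffineSurfaceAreaInfty
        (fun i => T '' (K i : Set (EuclideanSpace ℝ (Fin n)))) =
      |LinearMap.det (T : EuclideanSpace ℝ (Fin n) →ₗ[ℝ] EuclideanSpace ℝ (Fin n))|⁻¹ *
        MixedAffine.mixedAffineSurfaceAreaInfty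
          (fun i => (K i : Set (EuclideanSpace ℝ (Fin n)))) ∧
    (|LinearMap.det (T : EuclideanSpace ℝ (Fin n) →ₗ[ℝ] EuclideanSpace ℝ (Fin n))| = 1 →
      (∀ p : ℝ, p ≠ -(n : ℝ) →
        MixedAffine.mixedAffineSurfaceArea p
            (fun i => T '' (K i : Set (EuclideanSpace ℝ (Fin n)))) =
          MixedAffine.mixedAffineSurfaceArea p
            (fun i => (K i : Set (EuclideanSpace ℝ (Fin n))))) ∧
      MixedAffine.mixedAffineSurfaceAreaInfty
          (fun i => T '' (K i : Set (EuclideanSpace ℝ (Fin n)))) =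
        MixedAffine.mixedAffineSurfaceAreaInfty
          (fun i => (K i : Set (EuclideanSpace ℝ (Fin n))))) := by
  have h0 : ∀ i, (0 : EuclideanSpace ℝ (Fin n)) ∈ K i := fun i => (hK i).zero_mem (hcent i)
  have h1 := fun p (hp : p ≠ -(n : ℝ)) => MixedAffine.mixedAffineSurfaceArea_image hn hK h0 T hp
  have h2 := MixedAffine.mixedAffineSurfaceAreaInfty_image hn
    (fun i => (K i : Set (EuclideanSpace ℝ (Fin n)))) T
  refine ⟨h1, h2, fun hdet => ⟨fun p hp => ?_, ?_⟩⟩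
  · rw [h1 p hp, hdet, Real.one_rpow, one_mul]
  · rw [h2, hdet, inv_one, one_mul]
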